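/- Let $\mathbb{K}\in\{\mathbb{R},\mathbb{C}\}$, let $(\Omega,\mathcal{M},\mu)$ be an arbitrary measure space, and for $1\le p\le\infty$ let $L_p(\Omega)$ be the Banach space of (classes of) $\mathbb{K}$-valued $p$-integrable functions (essentially bounded ones if $p=\infty$). A subset $A$ of a topological vector space $E$ is called *lineable* if $A\cup\{0\}$ contains an infinite dimensional vector subspace of $E$, and, for a cardinal $\alpha$, *$\alpha$-lineable* if $A\cup\{0\}$ contains a vector subspace of dimension $\alpha$. For cardinals $\alpha,\beta$, the set $A$ is called *$(\alpha,\beta)$-spaceable* if $\alpha<\beta$, $A$ is $\alpha$-lineable, and for every subspace $F_\alpha\subset A\cup\{0\}$ of dimension $\alpha$ there is a closed subspace $F_\beta$ of $E$ of dimension $\beta$ with $F_\alpha\subset F_\beta\subset A\cup\{0\}$. Let $\mathfrak{c}$ be the cardinality of $\mathbb{R}$. Let $1\le p\le\infty$ and let $\Gamma$ be a non-empty set with $\Gamma\subset(1,\infty]$ if $p=1$, and $\Gamma\subset[1,p)$ or $\Gamma\subset(p,\infty]$ if $p>1$. Suppose that $$A:=L_p(\Omega)\smallsetminus\bigcup_{q\in\Gamma}L_q(\Omega)$$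 is lineable (as a subset of $L_p(\Omega)$). 1. If $p<\infty$, or if $p=\infty$ and there is a measurable set $S\subset\Omega$ with $0<\mu(S)<\infty$, then for every cardinal $\alpha$, the set $A$ is $(\alpha,\mathfrak{c})$-spaceable in $L_p(\Omega)$ if and only if $\alpha<\aleph_0$. 2. In all cases (also when $p=\infty$ and there is no such $S$), $A$ is $(\alpha,\mathfrak{c})$-spaceable in $L_p(\Omega)$ for every cardinal $\alpha<\aleph_0$. -/

import Mathlib

open Set MeasureTheory
open scoped ENNReal Cardinal

namespace Lineability

/-- `A` is lineable: `A ∪ {0}` contains an infinite dimensional vector subspace. -/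
def IsLineable (𝕜 : Type*) {E : Type*} [Field 𝕜] [AddCommGroup E] [Module 𝕜 E]
    (A : Set E) : Prop :=
  ∃ F : Submodule 𝕜 E, ℵ₀ ≤ Module.rank 𝕜 F ∧ (F : Set E) \ {0} ⊆ A

/-- `A` is `α`-lineable: `A ∪ {0}` contains a vector subspace of dimension exactly `α`. -/
def IsCardLineable (𝕜 : Type*) {E : Type*} [Field 𝕜] [AddCommGroup E] [Module 𝕜 E]
    (α : Cardinal) (A : Set E) : Prop :=
  ∃ F : Submodule 𝕜 E, Module.rank 𝕜 F = α ∧ (F : Set E) \ {0} ⊆ A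

/-- `A` is `(α, β)`-spaceable, where `α < β`: `A` is `α`-lineable, and every `α`-dimensional
subspace contained in `A ∪ {0}` is contained in a closed `β`-dimensional subspace that is itself
contained in `A ∪ {0}`. -/
def IsPairSpaceable (𝕜 : Type*) {E : Type*} [Field 𝕜] [AddCommGroup E] [Module 𝕜 E]
    [TopologicalSpace E] (α β : Cardinal) (A : Set E) : Prop :=
  α < β ∧ IsCardLineable 𝕜 α A ∧
    ∀ F : Submodule 𝕜 E, Module.rank 𝕜 F = α → (F : Set E) ⊆ A ∪ {0} →
      ∃ G : Submodule 𝕜 E, Module.rank 𝕜 G = β ∧ IsClosed (G : Set E) ∧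
        F ≤ G ∧ (G : Set E) ⊆ A ∪ {0}

/-- The set `L_p(μ) ∖ ⋃_{q ∈ Γ} L_q(μ)` of classes of `𝕜`-valued functions, as a subset of
`L_p(μ)`. -/
def lpDiffUnion (𝕜 : Type*) [RCLike 𝕜] {Ω : Type*} [MeasurableSpace Ω] (μ : Measure Ω)
    (p : ℝ≥0∞) (Γ : Set ℝ≥0∞) : Set (Lp 𝕜 p μ) :=
  {f | (f : Ω →ₘ[μ] 𝕜) ∉ ⋃ q ∈ Γ, (Lp 𝕜 q μ : Set (Ω →ₘ[μ] 𝕜))}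

end Lineability

/-! For exponents on one side of `p` the spaces `L_q ∩ L_p` are nested, by interpolation. The
elements of `L_p` lying in some `L_q`, `q ∈ Γ`, therefore form a subspace `U`, stable under
multiplication by indicators, and a subspace lies in `A ∪ {0}` exactly when it meets `U` trivially.

Lineability provides a sequence `g k ∉ U` with disjoint supports (`nonempty_blocks`): a suitable
function is cut into level shells, which are regrouped into infinitely many families, each still
carrying infinite `q`-norms. The functions that are multiples of `g k` on each block form a closed
space of dimension `𝔠` meeting `U` trivially. Given a finite dimensional `F` with `F ∩ U = 0`, a
subsequence of blocks can be chosen so that non-zero elements of `F` stay outside `U` away from the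
blocks (`Blocks.exists_subseq`); adding `F` to the block space then gives the required extension.

Conversely, if `U` contains some `u ≠ 0`, an infinite dimensional space meeting `U` trivially can be
tilted towards `u` so that its closure contains `u` (`exists_submodule_mem_closure`); no closed
space inside `A ∪ {0}` can contain the tilted one. An indicator of a set of finite positive measure
serves as `u`. -/

namespace Lineability

open Filter Topology

/-! ### Truncation, interpolation and splitting of functions -/

section Functions

variable {Ω F : Type*} [MeasurableSpace Ω] [NormedAddCommGroup F] {μ : Measure Ω} {f : Ω → F}
  {p q r : ℝ≥0∞}

/-- A bounded `p`-integrable function is `q`-integrable for every `q ≥ p`. -/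
theorem memLp_of_bounded (hp : p ≠ 0) (hpq : p ≤ q) (hf : MemLp f p μ) {C : ℝ}
    (hC : ∀ x, ‖f x‖ ≤ C) : MemLp f q μ := by
  rcases eq_or_ne q ∞ with rfl | hq
  · exact memLp_top_of_bound hf.1 C (.of_forall hC)
  have hp' : p ≠ ∞ := ne_top_of_le_ne_top hq hpq
  have hq0 : q ≠ 0 := fun h => hp (le_antisymm (h ▸ hpq) bot_le)
  refine ⟨hf.1, ?_⟩
  rw [eLpNorm_lt_top_iff_lintegral_rpow_enorm_lt_top hq0 hq]
  have hfin := (eLpNorm_lt_top_iff_lintegral_rpow_enorm_lt_top hp hp').1 hf.2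
  have hle : p.toReal ≤ q.toReal := (ENNReal.toReal_le_toReal hp' hq).2 hpq
  have hpp : 0 < p.toReal := ENNReal.toReal_pos hp hp'
  calc ∫⁻ x, ‖f x‖ₑ ^ q.toReal ∂μ
      ≤ ∫⁻ x, ENNReal.ofReal C ^ (q.toReal - p.toReal) * ‖f x‖ₑ ^ p.toReal ∂μ := by
        refine lintegral_mono fun x => ?_
        have hx : ‖f x‖ₑ ≤ ENNReal.ofReal C := by
          rw [← ofReal_norm]
          exact ENNReal.ofReal_le_ofReal (hC x)
        calc ‖f x‖ₑ ^ q.toReal = ‖f x‖ₑ ^ (q.toReal - p.toReal) * ‖f x‖ₑ ^ p.toReal := by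
              rw [← ENNReal.rpow_add_of_nonneg _ _ (sub_nonneg.2 hle) hpp.le, sub_add_cancel]
          _ ≤ _ := by
              gcongr
    _ = ENNReal.ofReal C ^ (q.toReal - p.toReal) * ∫⁻ x, ‖f x‖ₑ ^ p.toReal ∂μ :=
        lintegral_const_mul' _ _
          (ENNReal.rpow_ne_top_of_nonneg (sub_nonneg.2 hle) ENNReal.ofReal_ne_top)
    _ < ∞ := ENNReal.mul_lt_top
          (ENNReal.rpow_lt_top_of_nonneg (sub_nonneg.2 hle) ENNReal.ofReal_ne_top) hfin

/-- Truncating a `p`-integrable function at height `C` makes it `q`-integrable for `q ≥ p`. -/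
theorem memLp_indicator_norm_le (hsm : StronglyMeasurable f) (hp : p ≠ 0) (hpq : p ≤ q)
    (hf : MemLp f p μ) (C : ℝ) : MemLp ({x | ‖f x‖ ≤ C}.indicator f) q μ := by
  have hs : MeasurableSet {x | ‖f x‖ ≤ C} :=
    measurableSet_le hsm.norm.measurable measurable_const
  refine memLp_of_bounded hp hpq (hf.indicator hs) (C := max C 0) fun x => ?_
  by_cases hx : ‖f x‖ ≤ C
  · simp [indicator, hx]
  · simp [indicator, hx]

/-- A `q`-integrable function restricted to a set of finite measure is `r`-integrable
for `r ≤ q`. -/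
theorem memLp_indicator_of_finite (hrq : r ≤ q) (hf : MemLp f q μ) {s : Set Ω}
    (hs : MeasurableSet s) (hμ : μ s ≠ ∞) : MemLp (s.indicator f) r μ :=
  (hf.indicator hs).mono_exponent_of_measure_support_ne_top
    (fun _ hx => indicator_of_notMem hx f) hμ hrq

/-- If `f` belongs to `L_p` and to `L_r`, then it belongs to `L_q` for all `q ∈ [p, r]`. -/
theorem memLp_interpolate (hsm : StronglyMeasurable f) (hp : p ≠ 0) (hpq : p ≤ q) (hqr : q ≤ r)
    (hfp : MemLp f p μ) (hfr : MemLp f r μ) : MemLp f q μ := by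
  rcases eq_or_ne p ∞ with rfl | hp'
  · rwa [top_le_iff.1 hpq]
  have hs : MeasurableSet {x | ‖f x‖ ≤ 1} :=
    measurableSet_le hsm.norm.measurable measurable_const
  -- The small values are controlled by the exponent `p`. The large ones live on a set of finite
  -- measure, by Chebyshev's inequality, and are controlled by `r`.
  rw [← indicator_self_add_compl {x | ‖f x‖ ≤ 1} f]
  refine (memLp_indicator_norm_le hsm hp hpq hfp 1).add
    (memLp_indicator_of_finite hqr hfr hs.compl (ne_top_of_le_ne_top
      (hfp.meas_ge_lt_top hp hp' (ε := 1) one_ne_zero).ne (measure_mono fun x hx => ?_)))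
  have hx' : ¬ ‖f x‖ ≤ 1 := hx
  exact (not_le.1 hx').le

/-- Suppose that `f` is exhausted by restrictions lying in all of the `L_{q i}`, but itself lies in
none of them. Then there are infinitely many disjoint sets such that no restriction of `f` to
one of them lies in any `L_{q i}`. -/
theorem exists_disjoint_indicator_not_memLp (hf : AEStronglyMeasurable f μ) (q : ℕ → ℝ≥0∞)
    {E : ℕ → Set Ω}
    (hE : Monotone E) (hEm : ∀ n, MeasurableSet (E n)) (hcov : ∀ x, f x ≠ 0 → ∃ n, x ∈ E n)
    (hmem : ∀ n i, MemLp ((E n).indicator f) (q i) μ) (hnot : ∀ i, ¬ MemLp f (q i) μ) :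
    ∃ B : ℕ → Set Ω, (∀ k, MeasurableSet (B k)) ∧ Pairwise (Function.onFun Disjoint B) ∧
      ∀ k i, ¬ MemLp ((B k).indicator f) (q i) μ := by
  -- Fatou's lemma: the part of `f` off `E m` has infinite norm, because the part on `E m` has
  -- finite norm.
  have htend : ∀ m i, Tendsto (fun n => eLpNorm ((E n \ E m).indicator f) (q i) μ) atTop (𝓝 ∞) := by
    intro m i
    have hlim : eLpNorm ((E m)ᶜ.indicator f) (q i) μ ≤
        liminf (fun n => eLpNorm ((E n \ E m).indicator f) (q i) μ) atTop := by
      refine Lp.eLpNorm_lim_le_liminf_eLpNorm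
        (fun n => hf.indicator ((hEm n).diff (hEm m))) _ (.of_forall fun x => ?_)
      refine tendsto_const_nhds.congr' ?_
      by_cases hx : f x = 0
      · exact .of_forall fun n => by simp [indicator, hx]
      obtain ⟨n₀, hn₀⟩ := hcov x hx
      filter_upwards [eventually_ge_atTop n₀] with n hn
      have : x ∈ E n := hE hn hn₀
      by_cases hm : x ∈ E m
      · rw [indicator_of_notMem (notMem_compl_iff.2 hm),
          indicator_of_notMem (s := E n \ E m) fun h => h.2 hm]
      · rw [indicator_of_mem (mem_compl hm), indicator_of_mem (s := E n \ E m) ⟨this, hm⟩]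
    have htop : eLpNorm ((E m)ᶜ.indicator f) (q i) μ = ∞ := by
      by_contra h
      refine hnot i ?_
      rw [← indicator_self_add_compl (E m) f]
      exact (hmem m i).add ⟨hf.indicator (hEm m).compl, lt_top_iff_ne_top.2 h⟩
    rw [htop, top_le_iff] at hlim
    exact tendsto_of_le_liminf_of_limsup_le (hlim ▸ le_rfl) le_top
  -- A single `n` treats the exponents `q 0, …, q j` at once, so each exponent is taken care of from
  -- some stage on.
  have hstep : ∀ m j : ℕ, ∃ n, m ≤ n ∧
      ∀ i ≤ j, (j : ℝ≥0∞) ≤ eLpNorm ((E n \ E m).indicator f) (q i) μ := by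
    intro m j
    have h1 : ∀ᶠ n in atTop, ∀ i ∈ Finset.range (j + 1),
        (j : ℝ≥0∞) ≤ eLpNorm ((E n \ E m).indicator f) (q i) μ :=
      (Filter.eventually_all_finset _).2 fun i _ =>
        (htend m i).eventually_const_le (ENNReal.natCast_lt_top j)
    obtain ⟨n, hn, hmn⟩ := (h1.and (eventually_ge_atTop m)).exists
    exact ⟨n, hmn, fun i hi => hn i (Finset.mem_range.2 (by omega))⟩
  choose next hle hbig using hstep
  let M : ℕ → ℕ := fun j => Nat.rec 0 (fun j m => next m j) j
  have hM : ∀ j, M (j + 1) = next (M j) j := fun j => rfl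
  have hMmono : Monotone M := monotone_nat_of_le_succ fun j => (hM j).symm ▸ hle _ _
  let D : ℕ → Set Ω := fun j => E (M (j + 1)) \ E (M j)
  have hDm : ∀ j, MeasurableSet (D j) := fun j => (hEm _).diff (hEm _)
  have hDlt : ∀ i j, i < j → Disjoint (D i) (D j) := by
    intro i j hij
    rw [Set.disjoint_left]
    exact fun x hx hx' => hx'.2 (hE (hMmono hij) hx.1)
  have hDdisj : ∀ i j, i ≠ j → Disjoint (D i) (D j) := by
    intro i j hij
    rcases lt_or_gt_of_ne hij with h | h
    · exact hDlt i j h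
    · exact (hDlt j i h).symm
  -- Each `B k` receives infinitely many shells. Since `j ≤ Nat.pair k j`, their norms are unbounded
  -- for every exponent.
  refine ⟨fun k => ⋃ j, D (Nat.pair k j), fun k => .iUnion fun j => hDm _, ?_, ?_⟩
  · intro k l hkl
    simp only [Function.onFun, disjoint_iUnion_left, disjoint_iUnion_right]
    exact fun i j => hDdisj _ _ fun h => hkl (Nat.pair_eq_pair.1 h).1
  · intro k i hmem'
    refine hmem'.2.ne (ENNReal.eq_top_of_forall_nnreal_le fun C => ?_)
    obtain ⟨n, hn⟩ := exists_nat_ge C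
    set j := max n i
    have h1 : j ≤ Nat.pair k j := Nat.right_le_pair k j
    calc (C : ℝ≥0∞) ≤ (Nat.pair k j : ℝ≥0∞) := by
          have : C ≤ (Nat.pair k j : NNReal) :=
            hn.trans (Nat.cast_le.2 ((le_max_left n i).trans h1))
          exact_mod_cast this
      _ ≤ eLpNorm ((D (Nat.pair k j)).indicator f) (q i) μ :=
          hbig _ _ i ((le_max_right n i).trans h1)
      _ ≤ eLpNorm ((⋃ j, D (Nat.pair k j)).indicator f) (q i) μ := by
          refine eLpNorm_mono fun x => ?_
          exact norm_indicator_le_of_subset (subset_iUnion (fun j => D (Nat.pair k j)) j) f x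

end Functions

/-! ### Replacing the set of exponents by a sequence -/

/-- Every non-empty set of extended nonnegative reals has a countable coinitial sequence. -/
theorem exists_seq_coinitial {Γ : Set ℝ≥0∞} (hne : Γ.Nonempty) :
    ∃ q : ℕ → ℝ≥0∞, (∀ i, q i ∈ Γ) ∧ ∀ r ∈ Γ, ∃ i, q i ≤ r := by
  by_cases h : sInf Γ ∈ Γ
  · exact ⟨fun _ => sInf Γ, fun _ => h, fun r hr => ⟨0, sInf_le hr⟩⟩
  obtain ⟨u, -, hu, hmem⟩ := exists_seq_tendsto_sInf hne (OrderBot.bddBelow Γ)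
  refine ⟨u, hmem, fun r hr => ?_⟩
  have hlt : sInf Γ < r := lt_of_le_of_ne (sInf_le hr) fun e => h (e ▸ hr)
  exact ((hu.eventually_lt_const hlt).exists).imp fun _ => le_of_lt

/-- Every non-empty set of extended nonnegative reals has a countable cofinal sequence. -/
theorem exists_seq_cofinal {Γ : Set ℝ≥0∞} (hne : Γ.Nonempty) :
    ∃ q : ℕ → ℝ≥0∞, (∀ i, q i ∈ Γ) ∧ ∀ r ∈ Γ, ∃ i, r ≤ q i := by
  by_cases h : sSup Γ ∈ Γ
  · exact ⟨fun _ => sSup Γ, fun _ => h, fun r hr => ⟨0, le_sSup hr⟩⟩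
  obtain ⟨u, -, hu, hmem⟩ := exists_seq_tendsto_sSup hne (OrderTop.bddAbove Γ)
  refine ⟨u, hmem, fun r hr => ?_⟩
  have hlt : r < sSup Γ := lt_of_le_of_ne (le_sSup hr) fun e => h (e ▸ hr)
  exact ((hu.eventually_const_lt hlt).exists).imp fun _ => le_of_lt

/-! ### Tilting a subspace towards a vector of `U` -/

section Abstract

variable {𝕜 E : Type*} [RCLike 𝕜] [NormedAddCommGroup E] [NormedSpace 𝕜 E]

/-- If `H` is a subspace meeting `U` trivially and `u ∈ U`, then for every infinite cardinal
`α ≤ dim H` there is an `α`-dimensional subspace meeting `U` trivially whose closure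
contains `u`. -/
theorem exists_submodule_mem_closure {U H : Submodule 𝕜 E} (hHU : Disjoint H U) {u : E}
    (hu : u ∈ U) {α : Cardinal} (hα : ℵ₀ ≤ α) (hH : α ≤ Module.rank 𝕜 H) :
    ∃ F : Submodule 𝕜 E, Module.rank 𝕜 F = α ∧ Disjoint F U ∧ u ∈ closure (F : Set E) := by
  obtain ⟨s, hs, hli⟩ := le_rank_iff_exists_linearIndependent.1 hH
  have hinf : Infinite s := Cardinal.infinite_iff.2 (hs ▸ hα)
  let e : ℕ ↪ s := Infinite.natEmbedding s
  let v : s → E := fun x => ((x : H) : E)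
  have hv : LinearIndependent 𝕜 v := hli.map' H.subtype H.ker_subtype
  -- Chosen so that `v (e n) / c (e n)` has norm `1 / (n + 1)`; the shift by one keeps `c (e 0)`
  -- non-zero. Values off the range of `e` do not matter.
  let c : s → 𝕜 := fun x => ((Function.invFun e x + 1 : ℕ) : 𝕜) * (‖v x‖ : 𝕜)
  obtain ⟨φ, hφ⟩ := LinearMap.exists_extend ((Finsupp.linearCombination 𝕜 c) ∘ₗ hv.repr)
  have hφv : ∀ x, φ (v x) = c x := by
    intro x
    have hx : v x ∈ Submodule.span 𝕜 (range v) := Submodule.subset_span ⟨x, rfl⟩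
    have := LinearMap.congr_fun hφ ⟨v x, hx⟩
    simpa [hv.repr_eq_single x ⟨v x, hx⟩ rfl] using this
  -- Modulo `U` the map `T` is the inclusion of `H`, so it is injective and its range meets `U`
  -- trivially.
  let T : H →ₗ[𝕜] E := H.subtype + (LinearMap.toSpanSingleton 𝕜 E u) ∘ₗ φ ∘ₗ H.subtype
  have hT : ∀ h : H, T h = h + φ h • u := fun h => rfl
  have hTU : ∀ h : H, T h ∈ U → h = 0 := by
    intro h hh
    have h1 : (h : E) ∈ U := by
      have := U.sub_mem hh (U.smul_mem (φ h) hu)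
      rwa [hT, add_sub_cancel_right] at this
    exact Subtype.ext (Submodule.disjoint_def.1 hHU _ h.2 h1)
  have hTinj : LinearMap.ker T = ⊥ :=
    LinearMap.ker_eq_bot'.2 fun h hh => hTU h (hh ▸ U.zero_mem)
  refine ⟨Submodule.span 𝕜 (range fun x : s => T x), ?_, ?_, ?_⟩
  · have hTli : LinearIndependent 𝕜 fun x : s => T x := hli.map' T hTinj
    rw [rank_span hTli, Cardinal.mk_range_eq _ hTli.injective, hs]
  · rw [Submodule.disjoint_def]
    intro x hx hxU
    have : x ∈ LinearMap.range T := by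
      refine Submodule.span_le.2 ?_ hx
      rintro _ ⟨y, rfl⟩
      exact ⟨y, rfl⟩
    obtain ⟨h, rfl⟩ := this
    rw [hTU h hxU, map_zero]
  · have hne : ∀ n, v (e n) ≠ 0 := fun n => hv.ne_zero _
    have hc : ∀ n, c (e n) = ((n + 1 : ℕ) : 𝕜) * (‖v (e n)‖ : 𝕜) := fun n => by
      simp only [c, Function.leftInverse_invFun e.injective n]
    have hc0 : ∀ n, c (e n) ≠ 0 := fun n => by
      rw [hc]
      exact mul_ne_zero (Nat.cast_ne_zero.2 n.succ_ne_zero)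
        (by simpa using hne n)
    have hlim : Tendsto (fun n => (c (e n))⁻¹ • v (e n)) atTop (𝓝 0) := by
      rw [tendsto_zero_iff_norm_tendsto_zero]
      refine tendsto_one_div_add_atTop_nhds_zero_nat.congr fun n => ?_
      have := norm_ne_zero_iff.2 (hne n)
      rw [norm_smul, norm_inv, hc, norm_mul, RCLike.norm_natCast, RCLike.norm_ofReal, abs_norm]
      push_cast
      field_simp
    refine mem_closure_of_tendsto (f := fun n => (c (e n))⁻¹ • T (e n)) (b := atTop) ?_
      (.of_forall fun n => Submodule.smul_mem _ _ (Submodule.subset_span ⟨e n, rfl⟩))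
    have : ∀ n, (c (e n))⁻¹ • T (e n) = (c (e n))⁻¹ • v (e n) + u := by
      intro n
      rw [hT, smul_add, smul_smul, show φ ((e n : H) : E) = c (e n) from hφv (e n),
        inv_mul_cancel₀ (hc0 n), one_smul]
    simp only [this]
    simpa using hlim.add_const u

end Abstract

/-! ### Restriction operators on `L_p` -/

section Restr

variable {𝕜 Ω : Type*} [RCLike 𝕜] [MeasurableSpace Ω] {μ : Measure Ω} {p : ℝ≥0∞} [Fact (1 ≤ p)]
  {s t : Set Ω}

/-- Multiplication by the indicator function of a measurable set, as an operator on `L_p`. -/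
noncomputable def restr (hs : MeasurableSet s) : Lp 𝕜 p μ →L[𝕜] Lp 𝕜 p μ :=
  LinearMap.mkContinuous
    { toFun := fun f => ((Lp.memLp f).indicator hs).toLp _
      map_add' := fun f g => by
        rw [← MemLp.toLp_add]
        refine MemLp.toLp_congr _ _ ?_
        rw [← indicator_add']
        exact (Lp.coeFn_add f g).indicator
      map_smul' := fun c f => by
        rw [RingHom.id_apply, ← MemLp.toLp_const_smul]
        refine MemLp.toLp_congr _ _ ?_
        refine (Lp.coeFn_smul c f).indicator.trans (.of_eq ?_)
        exact indicator_const_smul s c f } 1 fun f => by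
    rw [one_mul]
    refine Lp.norm_le_norm_of_ae_le ?_
    filter_upwards [((Lp.memLp f).indicator hs).coeFn_toLp] with x hx
    exact hx ▸ norm_indicator_le_norm_self _ _

theorem coeFn_restr (hs : MeasurableSet s) (f : Lp 𝕜 p μ) :
    restr hs f =ᵐ[μ] s.indicator f :=
  ((Lp.memLp f).indicator hs).coeFn_toLp

theorem restr_restr_of_subset (hs : MeasurableSet s) (ht : MeasurableSet t) (hst : s ⊆ t)
    (f : Lp 𝕜 p μ) : restr hs (restr ht f) = restr hs f := by
  refine Lp.ext ?_
  filter_upwards [coeFn_restr hs (restr ht f), coeFn_restr hs f, coeFn_restr ht f] with x h1 h2 h3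
  rw [h1, h2]
  by_cases hx : x ∈ s
  · rw [indicator_of_mem hx, indicator_of_mem hx, h3, indicator_of_mem (hst hx)]
  · rw [indicator_of_notMem hx, indicator_of_notMem hx]

theorem restr_restr_of_disjoint (hs : MeasurableSet s) (ht : MeasurableSet t) (hst : Disjoint s t)
    (f : Lp 𝕜 p μ) : restr hs (restr ht f) = 0 := by
  refine Lp.ext ?_
  filter_upwards [coeFn_restr hs (restr ht f), coeFn_restr ht f, Lp.coeFn_zero 𝕜 p μ]
    with x h1 h3 h0
  rw [h1, h0, Pi.zero_apply]
  by_cases hx : x ∈ s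
  · rw [indicator_of_mem hx, h3, indicator_of_notMem (hst.notMem_of_mem_left hx)]
  · rw [indicator_of_notMem hx]

theorem restr_add_restr_compl (hs : MeasurableSet s) (f : Lp 𝕜 p μ) :
    restr hs f + restr hs.compl f = f := by
  refine Lp.ext ?_
  filter_upwards [coeFn_restr hs f, coeFn_restr hs.compl f,
    Lp.coeFn_add (restr hs f) (restr hs.compl f)] with x h1 h2 h3
  rw [h3, Pi.add_apply, h1, h2]
  exact indicator_self_add_compl_apply s f x

/-- A function supported on a countable union of measurable sets vanishes if its restrictions to
these sets do. -/
theorem eq_zero_of_restr_eq_zero {B : ℕ → Set Ω} (hB : ∀ k, MeasurableSet (B k)) {f : Lp 𝕜 p μ}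
    (h0 : restr (MeasurableSet.iUnion hB).compl f = 0) (h : ∀ k, restr (hB k) f = 0) : f = 0 := by
  refine Lp.ext ?_
  have hk : ∀ k, ∀ᵐ x ∂μ, (B k).indicator f x = 0 := fun k => by
    filter_upwards [coeFn_restr (hB k) f, Lp.coeFn_zero 𝕜 p μ] with x h1 h2
    rw [← h1, h k, h2, Pi.zero_apply]
  filter_upwards [coeFn_restr (MeasurableSet.iUnion hB).compl f, Lp.coeFn_zero 𝕜 p μ,
    ae_all_iff.2 hk] with x h1 h2 h3
  rw [h2, Pi.zero_apply]
  by_cases hx : x ∈ ⋃ k, B k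
  · obtain ⟨k, hk⟩ := mem_iUnion.1 hx
    simpa [indicator_of_mem hk] using h3 k
  · rw [h0, h2, indicator_of_mem (mem_compl hx), Pi.zero_apply] at h1
    exact h1.symm

end Restr

/-! ### Closed spaces built from disjoint blocks -/

section Blocks

variable {𝕜 Ω : Type*} [RCLike 𝕜] [MeasurableSpace Ω] {μ : Measure Ω} {p : ℝ≥0∞} [Fact (1 ≤ p)]
  {U : Submodule 𝕜 (Lp 𝕜 p μ)}

variable (𝕜 μ p) in
/-- A sequence of functions with disjoint supports, none of which belongs to the subspace `U`. -/
structure Blocks (U : Submodule 𝕜 (Lp 𝕜 p μ)) where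
  B : ℕ → Set Ω
  g : ℕ → Lp 𝕜 p μ
  measurableSet : ∀ k, MeasurableSet (B k)
  disjoint : ∀ k l, k ≠ l → Disjoint (B k) (B l)
  restr_g : ∀ k, restr (measurableSet k) (g k) = g k
  notMem : ∀ k, g k ∉ U

namespace Blocks

variable (b : Blocks 𝕜 μ p U)

theorem measurableSet_iUnion : MeasurableSet (⋃ k, b.B k) := .iUnion b.measurableSet

theorem g_ne_zero (k : ℕ) : b.g k ≠ 0 := fun h => b.notMem k (h ▸ U.zero_mem)

/-- The functions supported on the union of the blocks which are multiples of `g k` on the `k`-th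
block. -/
noncomputable def space : Submodule 𝕜 (Lp 𝕜 p μ) :=
  LinearMap.ker (restr (𝕜 := 𝕜) (μ := μ) (p := p) b.measurableSet_iUnion.compl).toLinearMap ⊓
    ⨅ k, (Submodule.span 𝕜 {b.g k}).comap (restr (b.measurableSet k)).toLinearMap

theorem mem_space {f : Lp 𝕜 p μ} : f ∈ b.space ↔ restr b.measurableSet_iUnion.compl f = 0 ∧
    ∀ k, ∃ c : 𝕜, c • b.g k = restr (b.measurableSet k) f := by
  simp [space, Submodule.mem_iInf, Submodule.mem_span_singleton]

theorem isClosed_space : IsClosed (b.space : Set (Lp 𝕜 p μ)) := by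
  have h1 : (b.space : Set (Lp 𝕜 p μ)) =
      (restr (𝕜 := 𝕜) (μ := μ) (p := p) b.measurableSet_iUnion.compl) ⁻¹' {0} ∩
      ⋂ k, (restr (b.measurableSet k)) ⁻¹' (Submodule.span 𝕜 {b.g k} : Set (Lp 𝕜 p μ)) := by
    ext f
    simp [space]
  rw [h1]
  exact (isClosed_singleton.preimage (ContinuousLinearMap.continuous _)).inter
    (isClosed_iInter fun k => (Submodule.closed_of_finiteDimensional _).preimage
      (ContinuousLinearMap.continuous _))

/-- Restricting an element of `U` to a block gives a multiple of `g k` lying in `U`; as `g k ∉ U`,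
the coefficient vanishes. -/
theorem disjoint_space (hU : ∀ s (hs : MeasurableSet s), ∀ f ∈ U, restr hs f ∈ U) :
    Disjoint b.space U := by
  rw [Submodule.disjoint_def]
  intro f hf hfU
  obtain ⟨h0, hk⟩ := b.mem_space.1 hf
  refine eq_zero_of_restr_eq_zero b.measurableSet h0 fun k => ?_
  obtain ⟨c, hc⟩ := hk k
  have h1 : c • b.g k ∈ U := hc ▸ hU _ _ f hfU
  rcases eq_or_ne c 0 with rfl | h
  · rw [← hc, zero_smul]
  · exact absurd ((U.smul_mem_iff h).1 h1) (b.notMem k)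

/-- An element is determined by its sequence of block coefficients, and there are only `𝔠` scalar
sequences. -/
theorem rank_space_le : Module.rank 𝕜 b.space ≤ 𝔠 := by
  refine (rank_le_card 𝕜 b.space).trans ?_
  choose c hc using fun f : b.space => (b.mem_space.1 f.2).2
  let Φ : b.space → ℕ → ℝ × ℝ := fun f k => (RCLike.re (c f k), RCLike.im (c f k))
  have hΦ : Function.Injective Φ := by
    intro f f' h
    have hcc : ∀ k, c f k = c f' k := fun k =>
      RCLike.ext (congrArg Prod.fst (congrFun h k)) (congrArg Prod.snd (congrFun h k))
    refine Subtype.ext (sub_eq_zero.1 (eq_zero_of_restr_eq_zero b.measurableSet ?_ fun k => ?_))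
    · rw [map_sub, (b.mem_space.1 f.2).1, (b.mem_space.1 f'.2).1, sub_zero]
    · rw [map_sub, ← hc, ← hc, hcc, sub_self]
  have := Cardinal.lift_mk_le_lift_mk_of_injective hΦ
  simpa [Cardinal.mk_real, Cardinal.mk_pi] using this

/-- The sums `∑ t ^ k • e k`, `0 < t < 1`, over the normalized blocks are independent: their
coefficient sequences are distinct characters of the monoid `ℕ`, to which Dedekind's theorem
applies. -/
theorem le_rank_space : 𝔠 ≤ Module.rank 𝕜 b.space := by
  let e : ℕ → Lp 𝕜 p μ := fun k => ((‖b.g k‖ : 𝕜)⁻¹) • b.g k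
  have he : ∀ k, ‖e k‖ = 1 := fun k => by
    rw [norm_smul, norm_inv, RCLike.norm_ofReal, abs_norm,
      inv_mul_cancel₀ (norm_ne_zero_iff.2 (b.g_ne_zero k))]
  have he0 : ∀ k, e k ≠ 0 := fun k h => by simpa [h] using he k
  have hsum : ∀ t : Ioo (0 : ℝ) 1, Summable fun k => ((t : ℝ) : 𝕜) ^ k • e k := fun t => by
    refine Summable.of_norm_bounded (summable_geometric_of_lt_one t.2.1.le t.2.2) fun k => ?_
    rw [norm_smul, he, mul_one, norm_pow, RCLike.norm_ofReal, abs_of_pos t.2.1]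
  let x : Ioo (0 : ℝ) 1 → Lp 𝕜 p μ := fun t => ∑' k, ((t : ℝ) : 𝕜) ^ k • e k
  have hdiag : ∀ k, restr (b.measurableSet k) (e k) = e k := fun k => by
    rw [map_smul, b.restr_g]
  have hoff : ∀ k l, k ≠ l → restr (b.measurableSet k) (e l) = 0 := fun k l hkl => by
    rw [← hdiag l]
    exact restr_restr_of_disjoint _ _ (b.disjoint k l hkl) _
  have hxk : ∀ t k, restr (b.measurableSet k) (x t) = ((t : ℝ) : 𝕜) ^ k • e k := by
    intro t k
    rw [ContinuousLinearMap.map_tsum _ (hsum t), tsum_eq_single k, map_smul, hdiag]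
    intro l hl
    rw [map_smul, hoff k l hl.symm, smul_zero]
  have hxmem : ∀ t, x t ∈ b.space := by
    refine fun t => b.mem_space.2 ⟨?_, fun k => ?_⟩
    · rw [ContinuousLinearMap.map_tsum _ (hsum t)]
      refine (tsum_congr fun k => ?_).trans tsum_zero
      rw [map_smul, ← hdiag k, restr_restr_of_disjoint, smul_zero]
      exact disjoint_compl_left.mono_right (subset_iUnion b.B k)
    · rw [hxk]
      exact ⟨_, (smul_smul _ _ _).symm⟩
  have hpow : LinearIndependent 𝕜 fun t : Ioo (0 : ℝ) 1 =>
      (powersHom 𝕜 ((t : ℝ) : 𝕜) : Multiplicative ℕ → 𝕜) := by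
    refine (linearIndependent_monoidHom (Multiplicative ℕ) 𝕜).comp
      (fun t : Ioo (0 : ℝ) 1 => powersHom 𝕜 ((t : ℝ) : 𝕜)) fun t t' h => ?_
    exact Subtype.ext (RCLike.ofReal_injective ((powersHom 𝕜).injective h))
  have hli : LinearIndependent 𝕜 fun t => (⟨x t, hxmem t⟩ : b.space) := by
    rw [linearIndependent_iff'] at hpow ⊢
    intro S c hc
    refine hpow S c (funext fun k => ?_)
    have h1 : ∑ t ∈ S, c t • x t = 0 := by
      simpa using congrArg Subtype.val hc
    have h2 := congrArg (restr (b.measurableSet (Multiplicative.toAdd k))) h1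
    simp only [map_sum, map_smul, hxk, map_zero, smul_smul, ← Finset.sum_smul] at h2
    simpa [powersHom_apply] using (smul_eq_zero.1 h2).resolve_right (he0 _)
  have := hli.cardinal_lift_le_rank
  rw [Cardinal.mk_Ioo_real zero_lt_one] at this
  simpa using this

theorem rank_space : Module.rank 𝕜 b.space = 𝔠 := le_antisymm b.rank_space_le b.le_rank_space

/-- The subsequence of blocks given by an injective map. -/
def comp (σ : ℕ → ℕ) (hσ : Function.Injective σ) : Blocks 𝕜 μ p U where
  B k := b.B (σ k)
  g k := b.g (σ k)
  measurableSet _ := b.measurableSet _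
  disjoint _ _ h := b.disjoint _ _ (hσ.ne h)
  restr_g _ := b.restr_g _
  notMem _ := b.notMem _

theorem pair_injective (i : ℕ) : Function.Injective (Nat.pair i) :=
  fun _ _ h => (Nat.pair_eq_pair.1 h).2

/-- Given a finite dimensional space `F` meeting `U` trivially, one can pass to a subsequence of
blocks such that no non-zero element of `F` falls into `U` when it is restricted to the complement
of the blocks. -/
theorem exists_subseq (b : Blocks 𝕜 μ p U)
    (hU : ∀ s (hs : MeasurableSet s), ∀ f ∈ U, restr hs f ∈ U)
    (F : Submodule 𝕜 (Lp 𝕜 p μ)) [FiniteDimensional 𝕜 F] (hF : Disjoint F U) :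
    ∃ b' : Blocks 𝕜 μ p U, ∀ f ∈ F, restr b'.measurableSet_iUnion.compl f ∈ U → f = 0 := by
  -- `Nat.pair` splits the blocks into infinitely many disjoint subsequences. If each failed, the
  -- witnesses `f i` would be an infinite independent family in `F`.
  by_contra! hcon
  let b' : ℕ → Blocks 𝕜 μ p U := fun i => b.comp (Nat.pair i) (pair_injective i)
  choose f hfF hfU hf0 using fun i => hcon (b' i)
  have hdisj : ∀ i j, i ≠ j → Disjoint (⋃ k, (b' i).B k) (⋃ k, (b' j).B k) := by
    intro i j hij
    simp only [disjoint_iUnion_left, disjoint_iUnion_right]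
    exact fun k l => b.disjoint _ _ fun h => hij (Nat.pair_eq_pair.1 h).1
  have hli : LinearIndependent 𝕜 f := by
    rw [linearIndependent_iff']
    intro S c hc i hi
    have h1 := congrArg (restr (b' i).measurableSet_iUnion) hc
    rw [map_sum, map_zero, ← Finset.add_sum_erase _ _ hi] at h1
    -- The union of the `i`-th subsequence lies in the complement of the `j`-th, where `f j`
    -- restricts into `U`.
    have h2 : ∑ j ∈ S.erase i, restr (b' i).measurableSet_iUnion (c j • f j) ∈ U := by
      refine U.sum_mem fun j hj => ?_
      rw [map_smul, ← restr_restr_of_subset _ (b' j).measurableSet_iUnion.compl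
        (hdisj i j (Finset.ne_of_mem_erase hj).symm).subset_compl_right]
      exact U.smul_mem _ (hU _ _ _ (hfU j))
    have h3 : c i • restr (b' i).measurableSet_iUnion (f i) ∈ U := by
      rw [← map_smul, eq_neg_of_add_eq_zero_left h1]
      exact U.neg_mem h2
    by_contra hci
    refine hf0 i (Submodule.disjoint_def.1 hF _ (hfF i) ?_)
    rw [← restr_add_restr_compl (b' i).measurableSet_iUnion (f i)]
    exact U.add_mem ((U.smul_mem_iff hci).1 h3) (hfU i)
  have hli' : LinearIndependent 𝕜 fun i => (⟨f i, hfF i⟩ : F) :=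
    LinearIndependent.of_comp F.subtype hli
  exact not_finite_iff_infinite.2 (inferInstanceAs (Infinite ℕ)) hli'.finite

/-- Every finite dimensional space meeting `U` trivially extends to a closed space of dimension `𝔠`
meeting `U` trivially. -/
theorem exists_closed_extension (b : Blocks 𝕜 μ p U)
    (hU : ∀ s (hs : MeasurableSet s), ∀ f ∈ U, restr hs f ∈ U)
    (F : Submodule 𝕜 (Lp 𝕜 p μ)) [FiniteDimensional 𝕜 F] (hF : Disjoint F U) :
    ∃ G : Submodule 𝕜 (Lp 𝕜 p μ), Module.rank 𝕜 G = 𝔠 ∧ IsClosed (G : Set (Lp 𝕜 p μ)) ∧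
      F ≤ G ∧ Disjoint G U := by
  obtain ⟨b', hb'⟩ := b.exists_subseq hU F hF
  refine ⟨b'.space ⊔ F, ?_, Submodule.isClosed_sup_finiteDimensional _ _ b'.isClosed_space,
    le_sup_right, ?_⟩
  · refine le_antisymm ((Submodule.rank_add_le_rank_add_rank _ _).trans ?_)
      (b'.rank_space.symm.le.trans (Submodule.rank_mono le_sup_left))
    rw [b'.rank_space]
    exact (add_le_add_right ((Module.rank_lt_aleph0 𝕜 F).le.trans Cardinal.aleph0_le_continuum) 𝔠).trans
      Cardinal.continuum_add_self.le
  · rw [Submodule.disjoint_def]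
    intro x hx hxU
    obtain ⟨h, hh, f, hf, rfl⟩ := Submodule.mem_sup.1 hx
    -- Off the blocks `h` vanishes, so only `f` remains there and the choice of `b'` forces `f = 0`.
    have h1 := hU _ b'.measurableSet_iUnion.compl _ hxU
    rw [map_add, (b'.mem_space.1 hh).1, zero_add] at h1
    obtain rfl := hb' f hf h1
    rw [add_zero] at hxU ⊢
    exact Submodule.disjoint_def.1 (b'.disjoint_space hU) _ hh hxU

end Blocks

end Blocks

variable {𝕜 Ω : Type*} [RCLike 𝕜] [MeasurableSpace Ω] {μ : Measure Ω}

/-! ### Bounded functions vanishing at infinity, and sets of infinite measure -/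

section VanishingAtInfinity

/-- The bounded functions tending to zero on `T` along the sets of cofinite measure. -/
def vanishingOn (𝕜 : Type*) [RCLike 𝕜] (μ : Measure Ω) (T : Set Ω) :
    Submodule 𝕜 (Lp 𝕜 ∞ μ) where
  carrier := {f | Tendsto f (μ.cofinite ⊓ 𝓟 T) (𝓝 0)}
  add_mem' {f g} hf hg := by
    have h := Tendsto.add hf hg
    rw [add_zero] at h
    exact h.congr' (((Lp.coeFn_add f g).filter_mono
      (inf_le_left.trans Measure.cofinite_le_ae)).mono fun x hx => hx.symm)
  zero_mem' := tendsto_const_nhds.congr' (((Lp.coeFn_zero 𝕜 ∞ μ).filter_mono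
    (inf_le_left.trans Measure.cofinite_le_ae)).mono fun x hx => hx.symm)
  smul_mem' c f hf := by
    have h := Tendsto.const_smul hf c
    rw [smul_zero] at h
    exact h.congr' (((Lp.coeFn_smul c f).filter_mono
      (inf_le_left.trans Measure.cofinite_le_ae)).mono fun x hx => hx.symm)

theorem mem_vanishingOn {T : Set Ω} {f : Lp 𝕜 ∞ μ} :
    f ∈ vanishingOn 𝕜 μ T ↔ Tendsto f (μ.cofinite ⊓ 𝓟 T) (𝓝 0) := Iff.rfl

theorem inf_vanishingOn_le (T S : Set Ω) :
    vanishingOn 𝕜 μ S ⊓ vanishingOn 𝕜 μ (T \ S) ≤ vanishingOn 𝕜 μ T := by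
  rintro f ⟨h1, h2⟩
  refine (Tendsto.sup h1 h2).mono_left ?_
  rw [← inf_sup_left, sup_principal]
  exact inf_le_inf_left _ (principal_mono.2 fun x hx => (em (x ∈ S)).imp id fun h => ⟨hx, h⟩)

/-- If a set cannot be split into two parts of infinite measure, then every bounded function has
a limit on it along the sets of cofinite measure. -/
theorem exists_tendsto_of_not_split {T : Set Ω} (hT : MeasurableSet T)
    (h : ∀ S, MeasurableSet S → S ⊆ T → μ S < ∞ ∨ μ (T \ S) < ∞) (f : Lp 𝕜 ∞ μ) :
    ∃ c, Tendsto f (μ.cofinite ⊓ 𝓟 T) (𝓝 c) := by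
  rcases (μ.cofinite ⊓ 𝓟 T).eq_or_neBot with h0 | h0
  · exact ⟨0, h0 ▸ tendsto_bot⟩
  let V := Ultrafilter.of (μ.cofinite ⊓ 𝓟 T)
  have hV : (V : Filter Ω) ≤ μ.cofinite ⊓ 𝓟 T := Ultrafilter.of_le _
  -- On measurable sets the filter already decides like the ultrafilter `V`, so a limit along `V`,
  -- given by compactness, is a limit along the filter.
  have hdich : ∀ S, MeasurableSet S → S ∈ V → S ∈ μ.cofinite ⊓ 𝓟 T := by
    intro S hS hSV
    have hcof : ∀ R, μ R < ∞ → Rᶜ ∩ T ∈ μ.cofinite ⊓ 𝓟 T := fun R hR =>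
      inter_mem_inf (Measure.compl_mem_cofinite.2 hR) (mem_principal_self T)
    rcases h (T ∩ S) (hT.inter hS) inter_subset_left with h1 | h1
    · refine absurd ((V : Filter Ω).inter_sets hSV (hV (hcof _ h1))) ?_
      have : S ∩ ((T ∩ S)ᶜ ∩ T) = ∅ := by
        ext x
        simp only [mem_inter_iff, mem_compl_iff, mem_empty_iff_false]
        tauto
      rw [this]
      exact V.empty_notMem
    · refine mem_of_superset (hcof _ h1) ?_
      rintro x ⟨hx, hxT⟩
      by_contra hxS
      exact hx ⟨hxT, fun h => hxS h.2⟩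
  have hbdd : ∀ᵐ x ∂μ, f x ∈ Metric.closedBall (0 : 𝕜) ‖f‖ := by
    filter_upwards [ae_le_eLpNormEssSup (f := f) (μ := μ)] with x hx
    rw [mem_closedBall_zero_iff, Lp.norm_def, eLpNorm_exponent_top, ← toReal_enorm]
    exact ENNReal.toReal_mono ((eLpNorm_exponent_top (f := f) (μ := μ)) ▸ Lp.eLpNorm_ne_top f) hx
  have hmap : Metric.closedBall (0 : 𝕜) ‖f‖ ∈ V.map f :=
    hV ((inf_le_left.trans Measure.cofinite_le_ae) hbdd)
  obtain ⟨c, -, hc⟩ := (isCompact_closedBall (0 : 𝕜) ‖f‖).ultrafilter_le_nhds' _ hmap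
  refine ⟨c, Metric.nhds_basis_ball.tendsto_right_iff.2 fun ε hε => ?_⟩
  exact hdich _ ((Lp.stronglyMeasurable f).measurable measurableSet_ball)
    (hc (Metric.ball_mem_nhds c hε))

/-- Otherwise every bounded function has a limit on `T`, and subtracting a constant puts it into
`vanishingOn 𝕜 μ T`, whose codimension is then at most one. -/
theorem exists_split {T : Set Ω} (hT : MeasurableSet T) (hfin : ¬ (vanishingOn 𝕜 μ T).CoFG) :
    ∃ S, MeasurableSet S ∧ S ⊆ T ∧ μ S = ∞ ∧ μ (T \ S) = ∞ := by
  by_contra! hcon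
  refine hfin ?_
  have hlim := exists_tendsto_of_not_split (𝕜 := 𝕜) hT fun S hS hST => by
    by_contra! h
    exact hcon S hS hST (top_le_iff.1 h.1) (top_le_iff.1 h.2)
  let e : Lp 𝕜 ∞ μ := (memLp_top_const (1 : 𝕜)).toLp _
  refine Submodule.FG.cofg_of_codisjoint (S := Submodule.span 𝕜 {e}) ?_
    (Submodule.fg_span_singleton e)
  rw [codisjoint_iff, eq_top_iff]
  rintro f -
  obtain ⟨c, hc⟩ := hlim f
  refine Submodule.mem_sup.2 ⟨c • e, Submodule.smul_mem _ _ (Submodule.mem_span_singleton_self e),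
    f - c • e, ?_, add_sub_cancel _ _⟩
  have h0 := hc.sub_const c
  rw [sub_self] at h0
  refine h0.congr' (EventuallyEq.filter_mono (l := ae μ) ?_
    (inf_le_left.trans Measure.cofinite_le_ae))
  filter_upwards [Lp.coeFn_sub f (c • e), Lp.coeFn_smul c e,
    (memLp_top_const (μ := μ) (1 : 𝕜)).coeFn_toLp] with x h1 h2 h3
  rw [h1, Pi.sub_apply, h2, Pi.smul_apply, h3, smul_eq_mul, mul_one]

/-- One of the two parts of infinite measure can be chosen with infinite codimension again. -/
theorem exists_split_not_cofg {T : Set Ω} (hT : MeasurableSet T)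
    (hfin : ¬ (vanishingOn 𝕜 μ T).CoFG) :
    ∃ S, MeasurableSet S ∧ S ⊆ T ∧ ¬ (vanishingOn 𝕜 μ S).CoFG ∧ μ (T \ S) = ∞ := by
  obtain ⟨S, hS, hST, h1, h2⟩ := exists_split hT hfin
  -- The two parts cannot both have finite codimension: the intersection of their spaces is
  -- contained in that of `T`.
  by_cases h : (vanishingOn 𝕜 μ S).CoFG
  · refine ⟨T \ S, hT.diff hS, sdiff_subset, fun h' => hfin ?_, ?_⟩
    · exact Submodule.CoFG.of_le (inf_vanishingOn_le T S) (h.inf h')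
    · rwa [sdiff_sdiff_cancel_left hST]
  · exact ⟨S, hS, hST, h, h2⟩

/-- Repeated splitting gives a decreasing sequence; the pieces discarded at each stage are disjoint
and of infinite measure. -/
theorem exists_disjoint_measure_eq_top (hfin : ¬ (vanishingOn 𝕜 μ univ).CoFG) :
    ∃ B : ℕ → Set Ω, (∀ k, MeasurableSet (B k)) ∧ Pairwise (Function.onFun Disjoint B) ∧
      ∀ k, μ (B k) = ∞ := by
  choose next hm hsub hnf hμ using fun T : {T : Set Ω // MeasurableSet T ∧
    ¬ (vanishingOn 𝕜 μ T).CoFG} => exists_split_not_cofg T.2.1 T.2.2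
  let T : ℕ → {T : Set Ω // MeasurableSet T ∧ ¬ (vanishingOn 𝕜 μ T).CoFG} := fun n =>
    Nat.rec ⟨univ, .univ, hfin⟩ (fun _ S => ⟨next S, hm S, hnf S⟩) n
  have hanti : Antitone fun n : ℕ => (T n).1 := antitone_nat_of_succ_le fun n => hsub (T n)
  have hlt : ∀ i j, i < j → Disjoint ((T i).1 \ (T (i + 1)).1) ((T j).1 \ (T (j + 1)).1) := by
    intro i j hij
    rw [Set.disjoint_left]
    exact fun x hx hx' => hx.2 (hanti hij hx'.1)
  refine ⟨fun n => (T n).1 \ (T (n + 1)).1, fun n => (T n).2.1.diff (T (n + 1)).2.1, ?_,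
    fun n => hμ _⟩
  intro i j hij
  rcases lt_or_gt_of_ne hij with h | h
  · exact hlt i j h
  · exact (hlt j i h).symm

end VanishingAtInfinity

theorem exists_ne_zero_forall_memLp {p : ℝ≥0∞} {s : Set Ω} (hs : MeasurableSet s) (h0 : 0 < μ s)
    (h1 : μ s < ∞) : ∃ u : Lp 𝕜 p μ, u ≠ 0 ∧ ∀ q, MemLp u q μ := by
  refine ⟨indicatorConstLp p hs h1.ne 1, fun h => h0.ne' ?_, fun q => ?_⟩
  · rw [measure_eq_zero_iff_ae_notMem]
    filter_upwards [indicatorConstLp_coeFn (p := p) (hs := hs) (hμs := h1.ne) (c := (1 : 𝕜)),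
      Lp.coeFn_zero 𝕜 p μ] with x hx hx0 hxs
    rw [h, hx0, indicator_of_mem hxs] at hx
    exact zero_ne_one hx
  · exact (memLp_congr_ae indicatorConstLp_coeFn).2 (memLp_indicator_const q hs 1 (.inr h1.ne))

/-! ### Existence of blocks -/

section Existence

variable {p : ℝ≥0∞} [Fact (1 ≤ p)] {U : Submodule 𝕜 (Lp 𝕜 p μ)} {q : ℕ → ℝ≥0∞}

theorem memLp_restr_iff {r : ℝ≥0∞} {s : Set Ω} (hs : MeasurableSet s) (f : Lp 𝕜 p μ) :
    MemLp (restr hs f) r μ ↔ MemLp (s.indicator f) r μ :=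
  memLp_congr_ae (coeFn_restr hs f)

theorem nonempty_blocks_of_indicator (hU : ∀ f : Lp 𝕜 p μ, f ∈ U ↔ ∃ i, MemLp f (q i) μ)
    {B : ℕ → Set Ω} (hB : ∀ k, MeasurableSet (B k)) (hd : Pairwise (Function.onFun Disjoint B))
    (f : Lp 𝕜 p μ) (hf : ∀ k i, ¬ MemLp ((B k).indicator f) (q i) μ) :
    Nonempty (Blocks 𝕜 μ p U) :=
  ⟨{ B := B
     g := fun k => restr (hB k) f
     measurableSet := hB
     disjoint := fun _ _ h => hd h
     restr_g := fun k => restr_restr_of_subset _ _ Subset.rfl f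
     notMem := fun k h => by
      obtain ⟨i, hi⟩ := (hU _).1 h
      exact hf k i ((memLp_restr_iff (hB k) f).1 hi) }⟩

/-- Splitting a function according to its large values. -/
theorem nonempty_blocks_of_le (hU : ∀ f : Lp 𝕜 p μ, f ∈ U ↔ ∃ i, MemLp f (q i) μ)
    (hq : ∀ i, p ≤ q i) {f : Lp 𝕜 p μ} (hf : f ∉ U) : Nonempty (Blocks 𝕜 μ p U) := by
  have hp : p ≠ 0 := (zero_lt_one.trans_le Fact.out).ne'
  have hsm := Lp.stronglyMeasurable f
  obtain ⟨B, hB, hd, hn⟩ := exists_disjoint_indicator_not_memLp (μ := μ) (f := f)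
    hsm.aestronglyMeasurable q (E := fun n : ℕ => {x | ‖f x‖ ≤ n})
    (fun m n hmn x hx => le_trans (b := (m : ℝ)) hx (Nat.cast_le.2 hmn))
    (fun n => measurableSet_le hsm.norm.measurable measurable_const)
    (fun x _ => exists_nat_ge ‖f x‖)
    (fun n i => memLp_indicator_norm_le hsm hp (hq i) (Lp.memLp f) n)
    (fun i hi => hf ((hU f).2 ⟨i, hi⟩))
  exact nonempty_blocks_of_indicator hU hB hd f hn

/-- Splitting a function according to its small values. -/
theorem nonempty_blocks_of_ge (hU : ∀ f : Lp 𝕜 p μ, f ∈ U ↔ ∃ i, MemLp f (q i) μ)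
    (hq : ∀ i, q i ≤ p) {f : Lp 𝕜 p μ} (hf : f ∉ U) (hfin : ∀ ε > 0, μ {x | ε ≤ ‖f x‖} < ∞) :
    Nonempty (Blocks 𝕜 μ p U) := by
  have hsm := Lp.stronglyMeasurable f
  have hE : ∀ n : ℕ, MeasurableSet {x | 1 / ((n : ℝ) + 1) ≤ ‖f x‖} := fun n =>
    measurableSet_le measurable_const hsm.norm.measurable
  obtain ⟨B, hB, hd, hn⟩ := exists_disjoint_indicator_not_memLp (μ := μ) (f := f)
    hsm.aestronglyMeasurable q (E := fun n : ℕ => {x | 1 / ((n : ℝ) + 1) ≤ ‖f x‖})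
    (fun m n hmn x hx => le_trans (b := 1 / ((m : ℝ) + 1)) (by gcongr) hx) hE
    (fun x hx => (exists_nat_one_div_lt (norm_pos_iff.2 hx)).imp fun n => le_of_lt)
    (fun n i => memLp_indicator_of_finite (hq i) (Lp.memLp f) (hE n)
      (hfin _ Nat.one_div_pos_of_nat).ne)
    (fun i hi => hf ((hU f).2 ⟨i, hi⟩))
  exact nonempty_blocks_of_indicator hU hB hd f hn

/-- For `p = ∞` a single function outside `U` may have no splitting, as its level sets can have
infinite measure. If `V` contains a non-zero function vanishing at infinity, its level sets are
finite and it can be split. If not, `V` embeds into the quotient by such functions, whose infinite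
dimension yields disjoint sets of infinite measure; their indicators are the blocks. -/
theorem nonempty_blocks_top {U : Submodule 𝕜 (Lp 𝕜 ∞ μ)}
    (hU : ∀ f : Lp 𝕜 ∞ μ, f ∈ U ↔ ∃ i, MemLp f (q i) μ) (hq : ∀ i, q i ≠ 0)
    (hq' : ∀ i, q i ≠ ∞) {V : Submodule 𝕜 (Lp 𝕜 ∞ μ)} (hV : ℵ₀ ≤ Module.rank 𝕜 V)
    (hVU : Disjoint V U) : Nonempty (Blocks 𝕜 μ ∞ U) := by
  by_cases hd : Disjoint V (vanishingOn 𝕜 μ univ)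
  · have hfin : ¬ (vanishingOn 𝕜 μ univ).CoFG := by
      intro h
      have : FiniteDimensional 𝕜 V := .of_fg (h.fg_of_disjoint hd)
      exact hV.not_gt (Module.rank_lt_aleph0 𝕜 V)
    obtain ⟨B, hB, hBd, hμ⟩ := exists_disjoint_measure_eq_top hfin
    refine nonempty_blocks_of_indicator hU hB hBd ((memLp_top_const (1 : 𝕜)).toLp _)
      fun k i h => ?_
    have h1 : MemLp ((B k).indicator fun _ => (1 : 𝕜)) (q i) μ :=
      (memLp_congr_ae (memLp_top_const (1 : 𝕜)).coeFn_toLp.indicator).1 h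
    rw [memLp_indicator_iff_restrict (hB k), memLp_const_iff (hq i) (hq' i)] at h1
    simp [hμ] at h1
  · rw [Submodule.disjoint_def] at hd
    push Not at hd
    obtain ⟨f, hfV, hf, hf0⟩ := hd
    refine nonempty_blocks_of_ge hU (fun i => le_top)
      (fun h => hf0 (Submodule.disjoint_def.1 hVU f hfV h)) fun ε hε => ?_
    rw [mem_vanishingOn, principal_univ, inf_top_eq] at hf
    have := Measure.eventually_cofinite.1 (hf.norm.eventually_lt_const (by simpa using hε))
    simpa using this

end Existence

/-! ### The subspace `U` and its blocks -/

section Main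

variable {p : ℝ≥0∞} [hp1 : Fact (1 ≤ p)] {Γ : Set ℝ≥0∞}

/-- The elements of `L_p` belonging to some `L_q` with `q ∈ Γ` form a subspace. -/
theorem exists_submodule_union (hne : Γ.Nonempty) (hΓ : Γ ⊆ Ico 1 p ∨ Γ ⊆ Ioc p ∞) :
    ∃ U : Submodule 𝕜 (Lp 𝕜 p μ), ∀ f : Lp 𝕜 p μ, f ∈ U ↔ ∃ q ∈ Γ, MemLp f q μ := by
  have hp : p ≠ 0 := (zero_lt_one.trans_le hp1.out).ne'
  have hmono : ∀ q ∈ Γ, ∀ r ∈ Γ, (∀ f : Lp 𝕜 p μ, MemLp f q μ → MemLp f r μ) ∨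
      ∀ f : Lp 𝕜 p μ, MemLp f r μ → MemLp f q μ := by
    have key : ∀ q ∈ Γ, ∀ r ∈ Γ, q ≤ r → (∀ f : Lp 𝕜 p μ, MemLp f q μ → MemLp f r μ) ∨
        ∀ f : Lp 𝕜 p μ, MemLp f r μ → MemLp f q μ := by
      intro q hq r hr hqr
      rcases hΓ with h | h
      · exact .inl fun f hf => memLp_interpolate (Lp.stronglyMeasurable f)
          (zero_lt_one.trans_le (h hq).1).ne' hqr (h hr).2.le hf (Lp.memLp f)
      · exact .inr fun f hf => memLp_interpolate (Lp.stronglyMeasurable f) hp (h hq).1.le hqr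
          (Lp.memLp f) hf
    intro q hq r hr
    rcases le_total q r with h | h
    · exact key q hq r hr h
    · exact (key r hr q hq h).symm
  refine ⟨{ carrier := {f : Lp 𝕜 p μ | ∃ q ∈ Γ, MemLp f q μ}
            add_mem' := ?_
            zero_mem' := ?_
            smul_mem' := ?_ }, fun f => Iff.rfl⟩
  · rintro f g ⟨q, hq, hf⟩ ⟨r, hr, hg⟩
    rcases hmono q hq r hr with h | h
    · exact ⟨r, hr, (memLp_congr_ae (Lp.coeFn_add f g)).2 ((h f hf).add hg)⟩
    · exact ⟨q, hq, (memLp_congr_ae (Lp.coeFn_add f g)).2 (hf.add (h g hg))⟩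
  · obtain ⟨q, hq⟩ := hne
    exact ⟨q, hq, (memLp_congr_ae (Lp.coeFn_zero 𝕜 p μ)).2 MemLp.zero⟩
  · rintro c f ⟨q, hq, hf⟩
    exact ⟨q, hq, (memLp_congr_ae (Lp.coeFn_smul c f)).2 (hf.const_smul c)⟩

theorem nonempty_blocks (hne : Γ.Nonempty) (hΓ : Γ ⊆ Ico 1 p ∨ Γ ⊆ Ioc p ∞)
    {U : Submodule 𝕜 (Lp 𝕜 p μ)} (hU : ∀ f : Lp 𝕜 p μ, f ∈ U ↔ ∃ q ∈ Γ, MemLp f q μ)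
    {V : Submodule 𝕜 (Lp 𝕜 p μ)} (hV : ℵ₀ ≤ Module.rank 𝕜 V) (hVU : Disjoint V U) :
    Nonempty (Blocks 𝕜 μ p U) := by
  have hp : p ≠ 0 := (zero_lt_one.trans_le hp1.out).ne'
  have hex : ∃ f, f ∉ U := by
    obtain ⟨f, hfV, hf0⟩ := V.exists_mem_ne_zero_of_ne_bot (by
      rintro rfl
      rw [rank_bot] at hV
      exact hV.not_gt Cardinal.aleph0_pos)
    exact ⟨f, fun h => hf0 (Submodule.disjoint_def.1 hVU f hfV h)⟩
  rcases hΓ with h | h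
  · obtain ⟨q, hq, hcof⟩ := exists_seq_cofinal hne
    have hU' : ∀ f : Lp 𝕜 p μ, f ∈ U ↔ ∃ i, MemLp f (q i) μ := by
      refine fun f => (hU f).trans ⟨?_, fun ⟨i, hi⟩ => ⟨q i, hq i, hi⟩⟩
      rintro ⟨r, hr, hf⟩
      obtain ⟨i, hi⟩ := hcof r hr
      exact ⟨i, memLp_interpolate (Lp.stronglyMeasurable f) (zero_lt_one.trans_le (h hr).1).ne' hi
        (h (hq i)).2.le hf (Lp.memLp f)⟩
    rcases eq_or_ne p ∞ with rfl | hp'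
    · exact nonempty_blocks_top hU' (fun i => (zero_lt_one.trans_le (h (hq i)).1).ne')
        (fun i => (h (hq i)).2.ne) hV hVU
    · obtain ⟨f, hf⟩ := hex
      refine nonempty_blocks_of_ge hU' (fun i => (h (hq i)).2.le) hf fun ε hε => ?_
      have := (Lp.memLp f).meas_ge_lt_top hp hp' (ε := ε.toNNReal) (Real.toNNReal_pos.2 hε).ne'
      refine (measure_mono fun x hx => ?_).trans_lt this
      exact Real.toNNReal_le_iff_le_coe.2 hx
  · obtain ⟨q, hq, hcof⟩ := exists_seq_coinitial hne
    have hU' : ∀ f : Lp 𝕜 p μ, f ∈ U ↔ ∃ i, MemLp f (q i) μ := by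
      refine fun f => (hU f).trans ⟨?_, fun ⟨i, hi⟩ => ⟨q i, hq i, hi⟩⟩
      rintro ⟨r, hr, hf⟩
      obtain ⟨i, hi⟩ := hcof r hr
      exact ⟨i, memLp_interpolate (Lp.stronglyMeasurable f) hp (h (hq i)).1.le hi (Lp.memLp f) hf⟩
    obtain ⟨f, hf⟩ := hex
    exact nonempty_blocks_of_le hU' (fun i => (h (hq i)).1.le) hf

/-- A non-zero function in `L_p` with `p < ∞` is non-zero on a set of finite positive measure. -/
theorem exists_measurableSet_finite_pos (hp : p ≠ ∞) {f : Lp 𝕜 p μ} (hf : f ≠ 0) :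
    ∃ s : Set Ω, MeasurableSet s ∧ 0 < μ s ∧ μ s < ∞ := by
  have hsm := Lp.stronglyMeasurable f
  have hpos : μ (⋃ n : ℕ, {x | 1 / ((n : ℝ) + 1) ≤ ‖f x‖}) ≠ 0 := by
    intro h0
    refine hf (Lp.ext ?_)
    filter_upwards [Lp.coeFn_zero 𝕜 p μ, measure_eq_zero_iff_ae_notMem.1 h0] with x h1 h2
    rw [h1, Pi.zero_apply]
    by_contra hx
    obtain ⟨n, hn⟩ := exists_nat_one_div_lt (norm_pos_iff.2 hx)
    exact h2 (mem_iUnion.2 ⟨n, hn.le⟩)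
  obtain ⟨n, hn⟩ := exists_measure_pos_of_not_measure_iUnion_null hpos
  refine ⟨_, measurableSet_le measurable_const hsm.norm.measurable, hn, ?_⟩
  have := (Lp.memLp f).meas_ge_lt_top (zero_lt_one.trans_le hp1.out).ne' hp
    (ε := (1 / ((n : ℝ) + 1)).toNNReal) (Real.toNNReal_pos.2 Nat.one_div_pos_of_nat).ne'
  exact (measure_mono fun x hx => Real.toNNReal_le_iff_le_coe.2 hx).trans_lt this

end Main

end Lineability

/-! ### Proof of the theorem -/

open Lineability

theorem corollaryc5 {𝕜 : Type*} [RCLike 𝕜] {Ω : Type*} [MeasurableSpace Ω] (μ : Measure Ω)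
    (p : ℝ≥0∞) [Fact (1 ≤ p)] (Γ : Set ℝ≥0∞) (hne : Γ.Nonempty)
    (hΓ : Γ ⊆ Ico 1 p ∨ Γ ⊆ Ioc p ∞)
    (hlin : Lineability.IsLineable 𝕜 (Lineability.lpDiffUnion 𝕜 μ p Γ)) :
    ((p = ∞ → ∃ s : Set Ω, MeasurableSet s ∧ 0 < μ s ∧ μ s < ∞) →
      ∀ α : Cardinal,
        Lineability.IsPairSpaceable 𝕜 α 𝔠 (Lineability.lpDiffUnion 𝕜 μ p Γ) ↔ α < ℵ₀) ∧
    (∀ α : Cardinal, α < ℵ₀ →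
      Lineability.IsPairSpaceable 𝕜 α 𝔠 (Lineability.lpDiffUnion 𝕜 μ p Γ)) := by
  obtain ⟨U, hU⟩ := exists_submodule_union (𝕜 := 𝕜) (μ := μ) hne hΓ
  have hA : ∀ f, f ∈ lpDiffUnion 𝕜 μ p Γ ↔ f ∉ U := by
    intro f
    simp only [lpDiffUnion, mem_ofPred_eq, mem_iUnion, SetLike.mem_coe, Lp.mem_Lp_iff_memLp, hU,
      exists_prop]
  have hdisj : ∀ F : Submodule 𝕜 (Lp 𝕜 p μ),
      (F : Set (Lp 𝕜 p μ)) ⊆ lpDiffUnion 𝕜 μ p Γ ∪ {0} ↔ Disjoint F U := by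
    intro F
    rw [Submodule.disjoint_def]
    refine ⟨fun h f hf hfU => (h hf).resolve_left fun h' => (hA f).1 h' hfU, fun h f hf => ?_⟩
    by_cases hfU : f ∈ U
    · exact .inr (h f hf hfU)
    · exact .inl ((hA f).2 hfU)
  have hdisj' : ∀ F : Submodule 𝕜 (Lp 𝕜 p μ),
      (F : Set (Lp 𝕜 p μ)) \ {0} ⊆ lpDiffUnion 𝕜 μ p Γ ↔ Disjoint F U := by
    intro F
    rw [← hdisj, sdiff_subset_iff, union_comm]
  obtain ⟨V, hV, hVA⟩ := hlin
  rw [hdisj'] at hVA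
  obtain ⟨b⟩ := nonempty_blocks hne hΓ hU hV hVA
  have hsolid : ∀ s (hs : MeasurableSet s), ∀ f ∈ U, restr hs f ∈ U := by
    intro s hs f hf
    obtain ⟨q, hq, hfq⟩ := (hU f).1 hf
    exact (hU _).2 ⟨q, hq, (memLp_restr_iff hs f).2 (hfq.indicator hs)⟩
  have hfinite : ∀ α : Cardinal, α < ℵ₀ → IsPairSpaceable 𝕜 α 𝔠 (lpDiffUnion 𝕜 μ p Γ) := by
    intro α hα
    refine ⟨hα.trans Cardinal.aleph0_lt_continuum, ?_, fun F hF hFA => ?_⟩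
    · obtain ⟨s, hs, hli⟩ := le_rank_iff_exists_linearIndependent.1 (hα.le.trans hV)
      have hli' : LinearIndependent 𝕜 fun x : s => ((x : V) : Lp 𝕜 p μ) :=
        LinearIndependent.map' hli V.subtype V.ker_subtype
      refine ⟨Submodule.span 𝕜 (range fun x : s => ((x : V) : Lp 𝕜 p μ)), ?_, ?_⟩
      · rw [rank_span hli', Cardinal.mk_range_eq _ hli'.injective, hs]
      · refine (hdisj' _).2 (hVA.mono_left (Submodule.span_le.2 ?_))
        rintro _ ⟨x, rfl⟩
        exact x.1.2
    · have : FiniteDimensional 𝕜 F := Module.rank_lt_aleph0_iff.1 (hF ▸ hα)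
      obtain ⟨G, h1, h2, h3, h4⟩ := b.exists_closed_extension hsolid F ((hdisj F).1 hFA)
      exact ⟨G, h1, h2, h3, (hdisj G).2 h4⟩
  refine ⟨fun hS α => ⟨fun hα => ?_, hfinite α⟩, hfinite⟩
  by_contra! hinf
  obtain ⟨s, hs, hs0, hs1⟩ : ∃ s : Set Ω, MeasurableSet s ∧ 0 < μ s ∧ μ s < ∞ := by
    rcases eq_or_ne p ∞ with hp | hp
    · exact hS hp
    · exact exists_measurableSet_finite_pos hp (b.g_ne_zero 0)
  obtain ⟨u, hu0, hu⟩ := exists_ne_zero_forall_memLp (𝕜 := 𝕜) (p := p) hs hs0 hs1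
  have huU : u ∈ U := (hU u).2 (hne.imp fun q hq => ⟨hq, hu q⟩)
  obtain ⟨F, hF, hFU, huF⟩ := exists_submodule_mem_closure (b.disjoint_space hsolid) huU hinf
    (b.rank_space ▸ hα.1.le)
  -- A closed `G ⊇ F` contains the non-zero `u ∈ U`, so it cannot meet `U` trivially.
  obtain ⟨G, -, hG, hFG, hGA⟩ := hα.2.2 F hF ((hdisj F).2 hFU)
  exact hu0 (Submodule.disjoint_def.1 ((hdisj G).1 hGA) u
    (closure_minimal (t := (G : Set (Lp 𝕜 p μ))) hFG hG huF) huU)
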